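/- Let $\theta$ be a measurable, possibly random, transformation of $[0,\infty)$: for each $z\ge 0$, $\theta(z)$ is a real random variable whose law is given by a Markov kernel (a deterministic measurable function is a special case), and distinct applications of $\theta$ use independent noise. Let $\operatorname{sign}$ be the sign function, with $\operatorname{sign}(0)\in\{-1,0,1\}$ fixed arbitrarily. Assume $$\lambda=\mathbb E\big(\operatorname{sign}(\theta(E_1)-\theta(E_2))\,(E_1-E_2)\big)>0,\qquad E_1,E_2\sim \mathrm{Exp}(1)\ \text{independent}.$$ Let $x_0\in\mathbb C^n$ with $\|x_0\|=1$, and let $a_i^1,a_i^2$ ($1\le i\le m$) be $2m$ i.i.d. complex Gaussian vectors with law $\mathcal N(0,\tfrac12 I_n)+i\,\mathcal N(0,\tfrac12 I_n)$. Put $$y_i=\operatorname{sign}\big(\theta(|\langle a_i^1,x_0\rangle|^2)-\theta(|\langle a_i^2,x_0\rangle|^2)\big),\quad \hat C_m=\frac1m\sum_{i=1}^m y_i\,(a_i^1a_i^{1,*}-a_i^2a_i^{2,*}),\quad C=\mathbb E\big(y_1(a_1^1a_1^{1,*}-a_1^2a_1^{2,*})\big).$$ **Proposition.** There are an absolute constant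 $c>0$ and, for every $\lambda>0$, a constant $K=K(\lambda)$ depending only on $\lambda$, such that for every $\theta$ with this value of $\lambda$ (and every choice of $\operatorname{sign}(0)$), all $n$, all unit vectors $x_0\in\mathbb C^n$, all $\varepsilon\in(0,1]$ and all $$m\ \ge\ \frac{c\,n\log n}{\lambda\,\varepsilon^2},$$ one has $\|\hat C_m-C\|\le\varepsilon\lambda$ in operator norm with probability at least $1-K n^{-2}$. -/

import Mathlib

open MeasureTheory ProbabilityTheory
open scoped ProbabilityTheory

noncomputable section

namespace OneBitPhase

/-- Assembles a vector of `ℂⁿ` from the pairs (real part, imaginary part) of its coordinates. -/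
def assemble (n : ℕ) (z : Fin n → ℝ × ℝ) : EuclideanSpace ℂ (Fin n) :=
  WithLp.toLp 2 fun k => (⟨(z k).1, (z k).2⟩ : ℂ)

theorem measurable_assemble (n : ℕ) : Measurable (assemble n) := by
  refine (WithLp.measurable_toLp 2 _).comp (measurable_pi_lambda _ fun k => ?_)
  exact Complex.measurableEquivRealProd.symm.measurable.comp (measurable_pi_apply k)

/-- The standard complex Gaussian law `N(0, I/2) + i N(0, I/2)` on `ℂⁿ`: the `2n` real and
imaginary parts of the coordinates are independent centred real Gaussians of variance `1/2`. -/
def complexGaussian (n : ℕ) : Measure (EuclideanSpace ℂ (Fin n)) :=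
  (Measure.pi fun _ : Fin n => (gaussianReal 0 (1 / 2)).prod (gaussianReal 0 (1 / 2))).map
    (assemble n)

instance (n : ℕ) : IsProbabilityMeasure (complexGaussian n) :=
  Measure.isProbabilityMeasure_map (measurable_assemble n).aemeasurable

/-- The intensity `|⟨a, x₀⟩|²`. -/
def intensity {n : ℕ} (x₀ a : EuclideanSpace ℂ (Fin n)) : ℝ := ‖inner ℂ a x₀‖ ^ 2

theorem measurable_intensity {n : ℕ} (x₀ : EuclideanSpace ℂ (Fin n)) :
    Measurable (intensity x₀) := by
  have h : Continuous (intensity x₀) := by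
    unfold intensity
    fun_prop
  exact h.measurable

/-- The sign of `s - t`, with the value `τ` in the case of a tie. -/
def signDiff (τ : SignType) (s t : ℝ) : SignType :=
  if t < s then 1 else if s < t then -1 else τ

/-- The joint law of a sensing vector `a` and of its perturbed measurement `b = θ(|⟨a, x₀⟩|²)`.
The possibly random transformation `θ` is a Markov kernel, `θ z` being the law of the value
observed in place of the intensity `z`; only `z ≥ 0` matters.  A deterministic `θ` is the kernel
`Kernel.deterministic θ _`. -/
def measurementLaw (θ : Kernel ℝ ℝ) {n : ℕ} (x₀ : EuclideanSpace ℂ (Fin n)) :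
    Measure (EuclideanSpace ℂ (Fin n) × ℝ) :=
  (complexGaussian n) ⊗ₘ (θ.comap (intensity x₀) (measurable_intensity x₀))

/-- The joint law of a standard exponential variable `E` and of `θ(E)`. -/
def expLaw (θ : Kernel ℝ ℝ) : Measure (ℝ × ℝ) := (expMeasure 1) ⊗ₘ θ

/-- `λ = 𝔼 (sign (θ(E₁) - θ(E₂)) (E₁ - E₂))` for independent `E₁, E₂ ∼ Exp(1)`. -/
def snr (τ : SignType) (θ : Kernel ℝ ℝ) : ℝ :=
  ∫ p, ((signDiff τ p.1.2 p.2.2 : SignType) : ℝ) * (p.1.1 - p.2.1) ∂(expLaw θ).prod (expLaw θ)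

/-- The matrix `sign(b¹ - b²) (a¹ a¹* - a² a²*)` formed from two measurements `(aʲ, bʲ)`. -/
def pairMatrix (τ : SignType) {n : ℕ} (u v : EuclideanSpace ℂ (Fin n) × ℝ) :
    Matrix (Fin n) (Fin n) ℂ :=
  ((signDiff τ u.2 v.2 : SignType) : ℂ) •
    (Matrix.vecMulVec u.1 (star (u.1 : Fin n → ℂ)) -
      Matrix.vecMulVec v.1 (star (v.1 : Fin n → ℂ)))

/-- `C = 𝔼 (y (a¹ a¹* - a² a²*))`, the expectation being taken entry by entry. -/
def expectedMatrix (τ : SignType) (θ : Kernel ℝ ℝ) {n : ℕ} (x₀ : EuclideanSpace ℂ (Fin n)) :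
    Matrix (Fin n) (Fin n) ℂ :=
  Matrix.of fun j k =>
    ∫ p, pairMatrix τ p.1 p.2 j k ∂(measurementLaw θ x₀).prod (measurementLaw θ x₀)

/-- `Ĉ_m = (1/m) ∑ᵢ yᵢ (aᵢ¹ aᵢ¹* - aᵢ² aᵢ²*)` for the measurements `w i 0 = (aᵢ¹, bᵢ¹)` and
`w i 1 = (aᵢ², bᵢ²)`. -/
def empiricalMatrix (τ : SignType) {n m : ℕ}
    (w : Fin m → Fin 2 → EuclideanSpace ℂ (Fin n) × ℝ) : Matrix (Fin n) (Fin n) ℂ :=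
  (m : ℂ)⁻¹ • ∑ i, pairMatrix τ (w i 0) (w i 1)

/-- The operator norm of a matrix with respect to the Euclidean norm of `ℂⁿ`. -/
def opNorm {n : ℕ} (M : Matrix (Fin n) (Fin n) ℂ) : ℝ :=
  ‖Matrix.toEuclideanCLM (n := Fin n) (𝕜 := ℂ) M‖

end OneBitPhase

end

namespace OneBitPhase

/-! The difference `Ĉ_m - C` is Hermitian, so its norm is controlled by its quadratic form on a
finite net. At a fixed unit vector `u` the form is a centred average of independent copies of
`pairForm τ u`. Since a sign has modulus at most 1, this variable is dominated by Gaussian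
intensities, and its exponential moments are bounded uniformly in `n`, `u` and `θ`
(`exists_exp_moment_complexGaussian`, `exp_moment_pairForm`). Bernstein's inequality
(`measureReal_abs_sum_ge_le`) and a union bound over at most `25 ^ (2 * n)` net points
(`norm_le_of_net`, `measureReal_opNorm_gt_le`) give failure probability at most `2 * 25 ^ (2 * n) *
exp (-δ n log n)` with `δ = δ(λ) > 0`. The logarithm beats the net for large `n`, however small `δ`
is; the remaining `n` are absorbed in `K(λ)` (`pow_mul_exp_neg_mul_log_le`). This is why `c` can be
absolute. -/

/-! ### Gaussian marginals and their exponential moments. -/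

theorem map_linear_gaussian_prod (v : NNReal) (p q : ℝ) :
    ((gaussianReal 0 v).prod (gaussianReal 0 v)).map (fun z => p * z.1 + q * z.2) =
      gaussianReal 0 (.mk (p ^ 2) (sq_nonneg _) * v + .mk (q ^ 2) (sq_nonneg _) * v) := by
  have hi : IndepFun (fun z : ℝ × ℝ => p * z.1) (fun z : ℝ × ℝ => q * z.2)
      ((gaussianReal 0 v).prod (gaussianReal 0 v)) :=
    indepFun_prod (by fun_prop : Measurable fun x : ℝ => p * x)
      (by fun_prop : Measurable fun x : ℝ => q * x)
  have h1 : HasLaw (fun z : ℝ × ℝ => z.1) (gaussianReal 0 v)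
      ((gaussianReal 0 v).prod (gaussianReal 0 v)) := measurePreserving_fst.hasLaw
  have h2 : HasLaw (fun z : ℝ × ℝ => z.2) (gaussianReal 0 v)
      ((gaussianReal 0 v).prod (gaussianReal 0 v)) := measurePreserving_snd.hasLaw
  have := gaussianReal_add_gaussianReal_of_indepFun hi
    (gaussianReal_const_mul h1 p).map_eq (gaussianReal_const_mul h2 q).map_eq
  rw [mul_zero, mul_zero, add_zero] at this
  exact this

/-- A sum of functions of the coordinates whose laws are centred Gaussian is Gaussian. -/
theorem hasLaw_sum_gaussian {ι : Type*} [Fintype ι] {α : Type*} [MeasurableSpace α]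
    (ν : Measure α) [IsProbabilityMeasure ν] (f : ι → α → ℝ) (hf : ∀ i, Measurable (f i))
    (v : ι → NNReal) (hv : ∀ i, ν.map (f i) = gaussianReal 0 (v i)) (s : Finset ι) :
    HasLaw (fun z : ι → α => ∑ i ∈ s, f i (z i)) (gaussianReal 0 (∑ i ∈ s, v i))
      (Measure.pi fun _ => ν) := by
  classical
  have hind : iIndepFun (fun i (z : ι → α) => f i (z i)) (Measure.pi fun _ => ν) :=
    iIndepFun_pi fun i => (hf i).aemeasurable
  induction s using Finset.induction_on with
  | empty =>
    simp only [Finset.sum_empty, gaussianReal_zero_var]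
    exact ⟨by fun_prop, by simp⟩
  | insert a s ha ih =>
    have hm : ∀ i, Measurable fun z : ι → α => f i (z i) := fun i =>
      (hf i).comp (measurable_pi_apply i)
    have h1 := (hind.indepFun_finsetSum_of_notMem hm ha).symm
    have h2 : (Measure.pi fun _ : ι => ν).map (fun z => f a (z a)) = gaussianReal 0 (v a) := by
      have h := Measure.map_map (μ := Measure.pi fun _ : ι => ν) (hf a) (measurable_pi_apply a)
      rw [(measurePreserving_eval (fun _ : ι => ν) a).map_eq, hv a] at h
      exact h.symm
    have h3 : (Measure.pi fun _ : ι => ν).map (∑ i ∈ s, fun z => f i (z i)) =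
        gaussianReal 0 (∑ i ∈ s, v i) := by
      rw [← ih.map_eq]
      congr 1
      ext z
      simp
    have h4 := gaussianReal_add_gaussianReal_of_indepFun h1 h2 h3
    refine ⟨(Finset.measurable_sum _ fun i _ => hm i).aemeasurable, ?_⟩
    rw [Finset.sum_insert ha, ← zero_add (0 : ℝ), ← h4]
    congr 1
    ext z
    simp [Finset.sum_insert ha]

/-- The real and imaginary parts of `⟨a, u⟩` are both of this form when `u` is a unit vector, so no
invariance of the full law under unitary maps is needed. -/
theorem hasLaw_linear_complexGaussian {n : ℕ} (p q : Fin n → ℝ)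
    (h : ∑ k, (p k ^ 2 + q k ^ 2) = 1) :
    HasLaw (fun a : EuclideanSpace ℂ (Fin n) => ∑ k, (p k * (a k).re + q k * (a k).im))
      (gaussianReal 0 (1 / 2)) (complexGaussian n) := by
  have h1 := hasLaw_sum_gaussian ((gaussianReal 0 (1 / 2)).prod (gaussianReal 0 (1 / 2)))
    (fun k (z : ℝ × ℝ) => p k * z.1 + q k * z.2) (fun k => by fun_prop) _
    (fun k => map_linear_gaussian_prod _ _ _) Finset.univ
  have hv : ∑ k, ((.mk (p k ^ 2) (sq_nonneg _) * (1 / 2) + .mk (q k ^ 2) (sq_nonneg _) * (1 / 2) :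
      NNReal)) = 1 / 2 := by
    rw [← NNReal.coe_inj]
    push_cast
    simp only [← add_mul, ← Finset.sum_mul, h]
    norm_num
  rw [hv] at h1
  have hm : Measurable fun a : EuclideanSpace ℂ (Fin n) =>
      ∑ k, (p k * (a k).re + q k * (a k).im) := by
    apply Continuous.measurable
    fun_prop
  refine ⟨hm.aemeasurable, ?_⟩
  rw [complexGaussian, Measure.map_map hm (measurable_assemble n)]
  exact h1.map_eq

theorem hasLaw_re_inner_complexGaussian {n : ℕ} {u : EuclideanSpace ℂ (Fin n)} (hu : ‖u‖ = 1) :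
    HasLaw (fun a => (inner ℂ a u).re) (gaussianReal 0 (1 / 2)) (complexGaussian n) := by
  convert hasLaw_linear_complexGaussian (fun k => (u k).re) (fun k => (u k).im) ?_ using 2 with a
  · simp only [PiLp.inner_apply, RCLike.inner_apply, Complex.re_sum]
    refine Finset.sum_congr rfl fun k _ => ?_
    simp
  · have := EuclideanSpace.norm_sq_eq u
    rw [hu] at this
    rw [← one_pow 2, this]
    refine Finset.sum_congr rfl fun k _ => ?_
    rw [Complex.sq_norm, Complex.normSq_apply]
    ring

theorem hasLaw_im_inner_complexGaussian {n : ℕ} {u : EuclideanSpace ℂ (Fin n)} (hu : ‖u‖ = 1) :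
    HasLaw (fun a => (inner ℂ a u).im) (gaussianReal 0 (1 / 2)) (complexGaussian n) := by
  convert hasLaw_linear_complexGaussian (fun k => (u k).im) (fun k => -(u k).re) ?_ using 2 with a
  · simp only [PiLp.inner_apply, RCLike.inner_apply, Complex.im_sum]
    refine Finset.sum_congr rfl fun k _ => ?_
    simp
    ring
  · have := EuclideanSpace.norm_sq_eq u
    rw [hu] at this
    rw [← one_pow 2, this]
    refine Finset.sum_congr rfl fun k _ => ?_
    rw [Complex.sq_norm, Complex.normSq_apply]
    ring

/-- The squared modulus of a unit marginal of the complex Gaussian law has an exponential moment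
bounded independently of the dimension and of the direction. -/
theorem exists_exp_moment_complexGaussian :
    ∃ γ : ℝ, 0 < γ ∧ ∃ M : ℝ, ∀ (n : ℕ) (u : EuclideanSpace ℂ (Fin n)), ‖u‖ = 1 →
      Integrable (fun a => Real.exp (γ * ‖inner ℂ a u‖ ^ 2)) (complexGaussian n) ∧
        ∫ a, Real.exp (γ * ‖inner ℂ a u‖ ^ 2) ∂(complexGaussian n) ≤ M := by
  obtain ⟨C, hC, hint⟩ := IsGaussian.exists_integrable_exp_sq (gaussianReal 0 (1 / 2))
  -- The Fernique exponent is halved so that convexity of `exp` separates the real and imaginary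
  -- parts, without using their independence.
  refine ⟨C / 2, by positivity, ∫ x, Real.exp (C * ‖x‖ ^ 2) ∂(gaussianReal 0 (1 / 2)), ?_⟩
  intro n u hu
  have hr := hasLaw_re_inner_complexGaussian hu
  have hi := hasLaw_im_inner_complexGaussian hu
  have hae : AEStronglyMeasurable (fun x : ℝ => Real.exp (C * ‖x‖ ^ 2))
      (gaussianReal 0 (1 / 2)) := hint.aestronglyMeasurable
  have ir : Integrable (fun a => Real.exp (C * ‖(inner ℂ a u).re‖ ^ 2)) (complexGaussian n) := by
    rw [← hr.map_eq] at hint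
    exact hint.comp_aemeasurable hr.aemeasurable
  have ii : Integrable (fun a => Real.exp (C * ‖(inner ℂ a u).im‖ ^ 2)) (complexGaussian n) := by
    rw [← hi.map_eq] at hint
    exact hint.comp_aemeasurable hi.aemeasurable
  have er := hr.integral_comp hae
  have ei := hi.integral_comp hae
  simp only [Function.comp_def] at er ei
  have key : ∀ a : EuclideanSpace ℂ (Fin n), Real.exp (C / 2 * ‖inner ℂ a u‖ ^ 2) ≤
      (1 / 2) * Real.exp (C * ‖(inner ℂ a u).re‖ ^ 2) +
        (1 / 2) * Real.exp (C * ‖(inner ℂ a u).im‖ ^ 2) := by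
    intro a
    have h := convexOn_exp.2 (Set.mem_univ (C * ‖(inner ℂ a u).re‖ ^ 2))
      (Set.mem_univ (C * ‖(inner ℂ a u).im‖ ^ 2)) (by norm_num : (0 : ℝ) ≤ 1 / 2)
      (by norm_num : (0 : ℝ) ≤ 1 / 2) (by norm_num)
    simp only [smul_eq_mul] at h
    refine le_trans (le_of_eq ?_) h
    rw [Complex.sq_norm, Complex.normSq_apply, Real.norm_eq_abs, Real.norm_eq_abs, sq_abs, sq_abs]
    ring_nf
  have isum := (ir.const_mul (1 / 2)).add (ii.const_mul (1 / 2))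
  have hint' : Integrable (fun a => Real.exp (C / 2 * ‖inner ℂ a u‖ ^ 2)) (complexGaussian n) := by
    refine isum.mono' (Continuous.aestronglyMeasurable (by fun_prop)) (ae_of_all _ fun a => ?_)
    rw [Real.norm_of_nonneg (Real.exp_pos _).le]
    exact key a
  refine ⟨hint', (integral_mono hint' isum key).trans (le_of_eq ?_)⟩
  rw [integral_add' (ir.const_mul _) (ii.const_mul _), integral_const_mul, integral_const_mul,
    er, ei]
  ring

/-! ### Bernstein's inequality from exponential moments. -/

theorem exp_le_one_add_add_sq_mul_exp_abs (y : ℝ) :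
    Real.exp y ≤ 1 + y + y ^ 2 * Real.exp |y| := by
  have h1 : 1 ≤ Real.exp |y| := Real.one_le_exp (abs_nonneg y)
  rcases le_or_gt |y| 1 with h | h
  · have := (abs_le.1 (Real.abs_exp_sub_one_sub_id_le h)).2
    nlinarith [sq_nonneg y]
  · rcases lt_abs.1 h with h | h
    · rw [abs_of_pos (by linarith)]
      have : 1 * Real.exp y ≤ y ^ 2 * Real.exp y := by
        gcongr
        nlinarith
      linarith
    · have : Real.exp y ≤ 1 := Real.exp_le_one_iff.2 (by linarith)
      nlinarith [sq_nonneg y]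

/-- Square `r ≤ exp r` at `r = γ|x|/4`. Only half of the exponent `γ` is spent on the square; the
other half is kept for `exp |s x|` with `|s| ≤ γ/2`. -/
theorem sq_le_mul_exp {γ : ℝ} (hγ : 0 < γ) (x : ℝ) :
    x ^ 2 ≤ 16 / γ ^ 2 * Real.exp (γ / 2 * |x|) := by
  have h1 : γ / 4 * |x| ≤ Real.exp (γ / 4 * |x|) := by
    linarith [Real.add_one_le_exp (γ / 4 * |x|)]
  have h2 : (γ / 4 * |x|) ^ 2 ≤ Real.exp (γ / 4 * |x|) ^ 2 := by gcongr
  rw [← Real.exp_nat_mul, mul_pow, sq_abs] at h2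
  have h3 : Real.exp (((2 : ℕ) : ℝ) * (γ / 4 * |x|)) = Real.exp (γ / 2 * |x|) := by
    congr 1
    push_cast
    ring
  rw [h3] at h2
  rw [div_mul_eq_mul_div, le_div_iff₀ (by positivity)]
  linarith

section SubExponential

variable {Ω : Type*} [MeasurableSpace Ω] {P : Measure Ω} [IsProbabilityMeasure P]

/-- Bernstein's bound on the moment generating function of a subexponential variable. -/
theorem mgf_sub_integral_le {X : Ω → ℝ} (hX : AEMeasurable X P) {γ M : ℝ} (hγ : 0 < γ)
    (hint : Integrable (fun ω => Real.exp (γ * |X ω|)) P)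
    (hM : ∫ ω, Real.exp (γ * |X ω|) ∂P ≤ M) {s : ℝ} (hs : |s| ≤ γ / 2) :
    Integrable (fun ω => Real.exp (s * (X ω - ∫ ω, X ω ∂P))) P ∧
      mgf (fun ω => X ω - ∫ ω, X ω ∂P) P s ≤ Real.exp (16 / γ ^ 2 * M * s ^ 2) := by
  have hXint : Integrable X P := by
    refine (hint.const_mul γ⁻¹).mono' hX.aestronglyMeasurable (ae_of_all _ fun ω => ?_)
    rw [Real.norm_eq_abs, inv_mul_eq_div, le_div_iff₀ hγ]
    linarith [Real.add_one_le_exp (γ * |X ω|)]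
  have hexp : Integrable (fun ω => Real.exp (s * X ω)) P := by
    refine hint.mono' (Real.measurable_exp.comp_aemeasurable
      (hX.const_mul s)).aestronglyMeasurable (ae_of_all _ fun ω => ?_)
    rw [Real.norm_of_nonneg (Real.exp_pos _).le, Real.exp_le_exp]
    calc s * X ω ≤ |s * X ω| := le_abs_self _
      _ = |s| * |X ω| := abs_mul _ _
      _ ≤ γ * |X ω| := by gcongr; linarith
  have hpt : ∀ ω, Real.exp (s * X ω) ≤
      1 + s * X ω + s ^ 2 * (16 / γ ^ 2) * Real.exp (γ * |X ω|) := by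
    intro ω
    refine (exp_le_one_add_add_sq_mul_exp_abs _).trans ?_
    have h1 : Real.exp |s * X ω| ≤ Real.exp (γ / 2 * |X ω|) := by
      rw [abs_mul]
      gcongr
    have h2 := sq_le_mul_exp hγ (X ω)
    have h3 : Real.exp (γ * |X ω|) = Real.exp (γ / 2 * |X ω|) * Real.exp (γ / 2 * |X ω|) := by
      rw [← Real.exp_add]
      ring_nf
    have h4 : (s * X ω) ^ 2 * Real.exp |s * X ω| ≤
        s ^ 2 * (16 / γ ^ 2 * Real.exp (γ / 2 * |X ω|)) * Real.exp (γ / 2 * |X ω|) := by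
      rw [mul_pow]
      gcongr
    rw [h3]
    linarith
  have hI : ∫ ω, Real.exp (s * X ω) ∂P ≤ 1 + s * ∫ ω, X ω ∂P + s ^ 2 * (16 / γ ^ 2) * M := by
    have i1 : Integrable (fun ω => 1 + s * X ω) P := (integrable_const 1).add (hXint.const_mul s)
    refine (integral_mono hexp (i1.add (hint.const_mul _)) hpt).trans ?_
    rw [integral_add' i1 (hint.const_mul _), integral_add (integrable_const 1) (hXint.const_mul s),
      integral_const_mul, integral_const_mul]
    simp only [integral_const, probReal_univ, smul_eq_mul, mul_one]
    gcongr
  have hfac : ∀ ω, Real.exp (s * (X ω - ∫ ω, X ω ∂P)) =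
      Real.exp (s * X ω) * Real.exp (-(s * ∫ ω, X ω ∂P)) := by
    intro ω
    rw [← Real.exp_add]
    ring_nf
  refine ⟨by simpa only [hfac] using hexp.mul_const _, ?_⟩
  simp only [mgf, hfac]
  rw [integral_mul_const]
  -- By `1 + r ≤ exp r` the second-order bound becomes an exponential, whose linear term is
  -- cancelled by the centring.
  calc _ ≤ Real.exp (s * ∫ ω, X ω ∂P + s ^ 2 * (16 / γ ^ 2) * M) *
        Real.exp (-(s * ∫ ω, X ω ∂P)) := by
        gcongr
        refine hI.trans ?_
        linarith [Real.add_one_le_exp (s * ∫ ω, X ω ∂P + s ^ 2 * (16 / γ ^ 2) * M)]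
    _ = _ := by
        rw [← Real.exp_add]
        ring_nf

/-- Bernstein's inequality for a sum of independent variables of the same mean. -/
theorem measureReal_abs_sum_ge_le {m : ℕ} {X : Fin m → Ω → ℝ} (hX : ∀ i, AEMeasurable (X i) P)
    (hind : iIndepFun X P) {μ γ M : ℝ} (hγ : 0 < γ) (hμ : ∀ i, ∫ ω, X i ω ∂P = μ)
    (hint : ∀ i, Integrable (fun ω => Real.exp (γ * |X i ω|)) P)
    (hM : ∀ i, ∫ ω, Real.exp (γ * |X i ω|) ∂P ≤ M) {s t : ℝ} (hs₀ : 0 ≤ s) (hs : s ≤ γ / 2) :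
    P.real {ω | m * t ≤ |∑ i, (X i ω - μ)|} ≤
      2 * Real.exp (-(m * (s * t - 16 / γ ^ 2 * M * s ^ 2))) := by
  have hY : ∀ i, AEMeasurable (fun ω => X i ω - μ) P := fun i => (hX i).sub_const μ
  have hYind : iIndepFun (fun i ω => X i ω - μ) P :=
    hind.comp (fun _ x => x - μ) fun _ => by fun_prop
  have hmgf : ∀ r : ℝ, |r| ≤ γ / 2 →
      Integrable (fun ω => Real.exp (r * (∑ i, fun ω => X i ω - μ) ω)) P ∧
      mgf (∑ i, fun ω => X i ω - μ) P r ≤ Real.exp (m * (16 / γ ^ 2 * M * r ^ 2)) := by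
    intro r hr
    have h := fun i => hμ i ▸ mgf_sub_integral_le (hX i) hγ (hint i) (hM i) hr
    -- A non-integrable function has integral 0 by convention, whereas the moment generating
    -- function of the sum is a product of positive factors.
    refine ⟨not_imp_comm.1 integral_undef ?_, ?_⟩
    · change mgf _ P r ≠ 0
      rw [hYind.mgf_sum₀ hY]
      exact Finset.prod_ne_zero_iff.2 fun i _ => (mgf_pos (h i).1).ne'
    rw [hYind.mgf_sum₀ hY]
    refine (Finset.prod_le_prod (fun i _ => mgf_nonneg) fun i _ => (h i).2).trans ?_
    rw [Finset.prod_const, Finset.card_univ, Fintype.card_fin, ← Real.exp_nat_mul]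
  have hup : P.real {ω | m * t ≤ (∑ i, fun ω => X i ω - μ) ω} ≤
      Real.exp (-(m * (s * t - 16 / γ ^ 2 * M * s ^ 2))) := by
    obtain ⟨h1, h2⟩ := hmgf s (by rwa [abs_of_nonneg hs₀])
    refine (measure_ge_le_exp_mul_mgf _ hs₀ h1).trans ?_
    refine (mul_le_mul_of_nonneg_left h2 (Real.exp_pos _).le).trans (le_of_eq ?_)
    rw [← Real.exp_add]
    ring_nf
  have hdown : P.real {ω | (∑ i, fun ω => X i ω - μ) ω ≤ -(m * t)} ≤
      Real.exp (-(m * (s * t - 16 / γ ^ 2 * M * s ^ 2))) := by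
    obtain ⟨h1, h2⟩ := hmgf (-s) (by rwa [abs_neg, abs_of_nonneg hs₀])
    refine (measure_le_le_exp_mul_mgf _ (neg_nonpos.2 hs₀) h1).trans ?_
    refine (mul_le_mul_of_nonneg_left h2 (Real.exp_pos _).le).trans (le_of_eq ?_)
    rw [← Real.exp_add]
    ring_nf
  have hsub : {ω | m * t ≤ |∑ i, (X i ω - μ)|} ⊆
      {ω | m * t ≤ (∑ i, fun ω => X i ω - μ) ω} ∪
        {ω | (∑ i, fun ω => X i ω - μ) ω ≤ -(m * t)} := by
    intro ω hω
    simp only [Set.mem_ofPred_eq, Set.mem_union, Finset.sum_apply] at hω ⊢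
    rcases le_abs.1 hω with h | h
    · exact Or.inl h
    · exact Or.inr (by linarith)
  calc _ ≤ _ := measureReal_mono hsub
    _ ≤ _ := measureReal_union_le _ _
    _ ≤ _ := by linarith

end SubExponential

/-! ### Nets of the unit ball and the operator norm. -/

section Net

variable {E : Type*} [NormedAddCommGroup E] [NormedSpace ℝ E] [FiniteDimensional ℝ E]

/-- A 1-separated subset of the ball of radius 2 has at most `5 ^ dim` points. One of maximal
cardinality is 1-covering for that ball, and scaling by 1/2 gives the net. -/
theorem exists_half_net :
    ∃ N : Finset E, N.card ≤ 5 ^ Module.finrank ℝ E ∧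
      ∀ x : E, ‖x‖ ≤ 1 → ∃ v ∈ N, ‖x - v‖ ≤ 1 / 2 := by
  classical
  let S : Set ℕ := {k | ∃ s : Finset E, s.card = k ∧ (∀ c ∈ s, ‖c‖ ≤ 2) ∧
    ∀ c ∈ s, ∀ d ∈ s, c ≠ d → 1 ≤ ‖c - d‖}
  have hb : ∀ k ∈ S, k ≤ 5 ^ Module.finrank ℝ E := by
    rintro k ⟨s, rfl, h1, h2⟩
    exact Besicovitch.card_le_of_separated s h1 h2
  have hne : S.Nonempty := ⟨0, ∅, by simp⟩
  have hbdd : BddAbove S := ⟨_, hb⟩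
  obtain ⟨s, hcard, h1, h2⟩ := Nat.sSup_mem hne hbdd
  refine ⟨s.image fun v => (1 / 2 : ℝ) • v,
    Finset.card_image_le.trans (Besicovitch.card_le_of_separated s h1 h2), fun x hx => ?_⟩
  have h2x : ‖(2 : ℝ) • x‖ ≤ 2 := by
    rw [norm_smul, Real.norm_of_nonneg (by norm_num)]
    linarith
  have hfar : ∃ v ∈ s, ‖(2 : ℝ) • x - v‖ ≤ 1 := by
    by_contra! hcon
    have hx' : (2 : ℝ) • x ∉ s := fun h => by
      have := hcon _ h
      simp at this
      linarith
    have hmem : s.card + 1 ∈ S := by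
      refine ⟨insert ((2 : ℝ) • x) s, Finset.card_insert_of_notMem hx', ?_, ?_⟩
      · intro c hc
        rcases Finset.mem_insert.1 hc with rfl | hc
        · exact h2x
        · exact h1 c hc
      · intro c hc d hd hcd
        rcases Finset.mem_insert.1 hc with rfl | hc
        · rcases Finset.mem_insert.1 hd with rfl | hd
          · exact absurd rfl hcd
          · exact (hcon d hd).le
        · rcases Finset.mem_insert.1 hd with rfl | hd
          · rw [norm_sub_rev]
            exact (hcon c hc).le
          · exact h2 c hc d hd hcd
    have := le_csSup hbdd hmem
    omega
  obtain ⟨v, hv, hxv⟩ := hfar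
  refine ⟨_, Finset.mem_image_of_mem _ hv, ?_⟩
  have : x - (1 / 2 : ℝ) • v = (1 / 2 : ℝ) • ((2 : ℝ) • x - v) := by
    rw [smul_sub, smul_smul]
    norm_num
  rw [this, norm_smul, Real.norm_of_nonneg (by norm_num)]
  linarith

/-- The half-net is applied a second time, to the doubled residual `2 (x - v)`; this squares the
cardinality bound. -/
theorem exists_quarter_net :
    ∃ N : Finset E, N.card ≤ 25 ^ Module.finrank ℝ E ∧
      ∀ x : E, ‖x‖ ≤ 1 → ∃ v ∈ N, ‖x - v‖ ≤ 1 / 4 := by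
  classical
  obtain ⟨N, hN, hcov⟩ := exists_half_net (E := E)
  refine ⟨(N ×ˢ N).image fun p => p.1 + (1 / 2 : ℝ) • p.2, ?_, fun x hx => ?_⟩
  · refine Finset.card_image_le.trans ?_
    rw [Finset.card_product]
    calc _ ≤ 5 ^ Module.finrank ℝ E * 5 ^ Module.finrank ℝ E := Nat.mul_le_mul hN hN
      _ = _ := by
        rw [← mul_pow]
        norm_num
  · obtain ⟨v, hv, hxv⟩ := hcov x hx
    obtain ⟨w, hw, hxw⟩ := hcov ((2 : ℝ) • (x - v)) (by
      rw [norm_smul, Real.norm_of_nonneg (by norm_num)]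
      linarith)
    refine ⟨v + (1 / 2 : ℝ) • w, Finset.mem_image.2 ⟨(v, w), by simp [hv, hw], rfl⟩, ?_⟩
    have : x - (v + (1 / 2 : ℝ) • w) = (1 / 2 : ℝ) • ((2 : ℝ) • (x - v) - w) := by
      rw [smul_sub, smul_smul]
      norm_num
      abel
    rw [this, norm_smul, Real.norm_of_nonneg (by norm_num)]
    linarith

end Net

/-- The norm of a symmetric operator is controlled by its quadratic form on a net. -/
theorem norm_le_of_net {E : Type*} [NormedAddCommGroup E] [InnerProductSpace ℂ E]
    (T : E →L[ℂ] E) (hT : (T : E →ₗ[ℂ] E).IsSymmetric) (N : Finset E)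
    (hN : ∀ x : E, ‖x‖ ≤ 1 → ∃ v ∈ N, ‖x - v‖ ≤ 1 / 4) {t : ℝ} (ht : 0 ≤ t)
    (h : ∀ v ∈ N, |(inner ℂ (T v) v).re| ≤ t * ‖v‖ ^ 2) : ‖T‖ ≤ 4 * t := by
  -- Net points need not be unit vectors, only of norm at most 5/4: hence `25/16 = (5/4)^2` and the
  -- error `1/4 + 5/16 = 9/16`. Absorbing the error leaves `25/7 ≤ 4`.
  have hunit : ∀ x : E, ‖x‖ = 1 → |(inner ℂ (T x) x).re| ≤ 25 / 16 * t + 9 / 16 * ‖T‖ := by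
    intro x hx
    obtain ⟨v, hv, hxv⟩ := hN x hx.le
    have hvn : ‖v‖ ≤ 5 / 4 := by
      have : v = x - (x - v) := by abel
      rw [this]
      refine (norm_sub_le _ _).trans ?_
      linarith
    have e : (inner ℂ (T x) x).re = (inner ℂ (T v) v).re +
        ((inner ℂ (T x) (x - v)).re + (inner ℂ (T (x - v)) v).re) := by
      simp only [map_sub, inner_sub_left, inner_sub_right, Complex.sub_re]
      ring
    have b1 : |(inner ℂ (T x) (x - v)).re| ≤ ‖T‖ * (1 / 4) := by
      refine (Complex.abs_re_le_norm _).trans ((norm_inner_le_norm _ _).trans ?_)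
      have := T.le_opNorm x
      rw [hx, mul_one] at this
      gcongr
    have b2 : |(inner ℂ (T (x - v)) v).re| ≤ ‖T‖ * (1 / 4) * (5 / 4) := by
      refine (Complex.abs_re_le_norm _).trans ((norm_inner_le_norm _ _).trans ?_)
      have := T.le_opNorm (x - v)
      have h' : ‖T (x - v)‖ ≤ ‖T‖ * (1 / 4) := this.trans (by gcongr)
      gcongr
    have b3 : t * ‖v‖ ^ 2 ≤ t * (5 / 4) ^ 2 := by gcongr
    rw [e]
    have := h v hv
    have := abs_add_le (inner ℂ (T v) v).re
      ((inner ℂ (T x) (x - v)).re + (inner ℂ (T (x - v)) v).re)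
    have := abs_add_le (inner ℂ (T x) (x - v)).re (inner ℂ (T (x - v)) v).re
    linarith
  have hq : ∀ x : E, |T.rayleighQuotient x| ≤ 25 / 16 * t + 9 / 16 * ‖T‖ := by
    intro x
    by_cases hx : x = 0
    · subst hx
      simp
      positivity
    · have hc : ((‖x‖ : ℂ)⁻¹) ≠ 0 := by simpa using hx
      rw [← T.rayleigh_smul x hc]
      have hn : ‖(‖x‖ : ℂ)⁻¹ • x‖ = 1 := by
        rw [norm_smul]
        simp [hx]
      rw [ContinuousLinearMap.rayleighQuotient, hn, ContinuousLinearMap.reApplyInnerSelf_apply]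
      rw [one_pow, div_one]
      exact hunit _ hn
  -- Symmetry enters here: the norm is the supremum of the absolute Rayleigh quotients.
  have : ‖T‖ ≤ 25 / 16 * t + 9 / 16 * ‖T‖ := by
    rw [T.norm_eq_iSup_rayleighQuotient hT] at hq ⊢
    exact ciSup_le hq
  linarith

/-! ### Independence of the rows of an independent array. -/

section Independence

variable {Ω : Type*} [MeasurableSpace Ω] {P : Measure Ω} [IsProbabilityMeasure P]

/-- Independence says that the joint law is a product measure, and currying turns a product over `ι
× κ` into a product of products. It is used to pass from `2m` independent measurements to `m`
independent pairs. -/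
theorem iIndepFun_curry {ι κ 𝓧 : Type*} [Countable ι] [Countable κ] [MeasurableSpace 𝓧]
    {X : ι × κ → Ω → 𝓧} (hX : ∀ p, AEMeasurable (X p) P) (h : iIndepFun X P) :
    iIndepFun (fun i ω j => X (i, j) ω) P := by
  have (p : ι × κ) : IsProbabilityMeasure (P.map (X p)) :=
    Measure.isProbabilityMeasure_map (hX p)
  have hrow : ∀ i, AEMeasurable (fun ω j => X (i, j) ω) P := fun i =>
    aemeasurable_pi_iff.2 fun j => hX (i, j)
  rw [iIndepFun_iff_map_fun_eq_infinitePi_map₀' hrow]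
  have h1 := h.map_fun_eq_infinitePi_map₀' hX
  have h2 := congrArg (Measure.map (MeasurableEquiv.curry ι κ 𝓧)) h1
  rw [Measure.infinitePi_map_curry fun i j => P.map (X (i, j)),
    AEMeasurable.map_map_of_aemeasurable (MeasurableEquiv.measurable _).aemeasurable
      (aemeasurable_pi_iff.2 hX)] at h2
  refine h2.trans ?_
  congr 1
  funext i
  exact ((h.precomp (Prod.mk_right_injective i)).map_fun_eq_infinitePi_map₀'
    fun j => hX (i, j)).symm

end Independence

/-! ### The quadratic forms of the random matrices. -/

section QuadraticForm

variable {n : ℕ}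

theorem inner_toEuclideanCLM_apply (M : Matrix (Fin n) (Fin n) ℂ)
    (u : EuclideanSpace ℂ (Fin n)) :
    inner ℂ (Matrix.toEuclideanCLM (n := Fin n) (𝕜 := ℂ) M u) u =
      ∑ j, ∑ k, u j * star (M j k) * star (u k) := by
  simp only [PiLp.inner_apply, RCLike.inner_apply, Matrix.ofLp_toEuclideanCLM, Matrix.mulVec,
    dotProduct, map_sum, map_mul, Finset.mul_sum, ← mul_assoc]
  rfl

theorem inner_toEuclideanCLM_vecMulVec (a u : EuclideanSpace ℂ (Fin n)) :
    inner ℂ (Matrix.toEuclideanCLM (n := Fin n) (𝕜 := ℂ)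
      (Matrix.vecMulVec a (star (a : Fin n → ℂ))) u) u = ((‖inner ℂ a u‖ ^ 2 : ℝ) : ℂ) := by
  rw [inner_toEuclideanCLM_apply, Complex.sq_norm, Complex.normSq_eq_conj_mul_self,
    PiLp.inner_apply, map_sum, mul_comm, Finset.sum_mul_sum]
  refine Finset.sum_congr rfl fun j _ => Finset.sum_congr rfl fun k _ => ?_
  simp only [Matrix.vecMulVec_apply, Pi.star_apply, RCLike.inner_apply, star_mul',
    map_mul, RCLike.star_def, Complex.conj_conj]
  ring

/-- The value `sign(b¹ - b²) (|⟨a¹, u⟩|² - |⟨a², u⟩|²)` of the quadratic form of `pairMatrix`. -/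
noncomputable def pairForm (τ : SignType) (u : EuclideanSpace ℂ (Fin n))
    (p : (EuclideanSpace ℂ (Fin n) × ℝ) × (EuclideanSpace ℂ (Fin n) × ℝ)) : ℝ :=
  ((signDiff τ p.1.2 p.2.2 : SignType) : ℝ) * (‖inner ℂ p.1.1 u‖ ^ 2 - ‖inner ℂ p.2.1 u‖ ^ 2)

theorem ofReal_signType (s : SignType) : (((s : SignType) : ℝ) : ℂ) = (s : ℂ) := by
  cases s <;> simp

theorem re_inner_pairMatrix (τ : SignType) (u : EuclideanSpace ℂ (Fin n))
    (p : (EuclideanSpace ℂ (Fin n) × ℝ) × (EuclideanSpace ℂ (Fin n) × ℝ)) :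
    (inner ℂ (Matrix.toEuclideanCLM (n := Fin n) (𝕜 := ℂ) (pairMatrix τ p.1 p.2) u) u).re =
      pairForm τ u p := by
  rw [pairMatrix, ← ofReal_signType, map_smul, map_sub, smul_apply,
    sub_apply, inner_smul_left, inner_sub_left,
    inner_toEuclideanCLM_vecMulVec, inner_toEuclideanCLM_vecMulVec, Complex.conj_ofReal,
    ← Complex.ofReal_sub, ← Complex.ofReal_mul, Complex.ofReal_re, pairForm]

theorem abs_signType_le (s : SignType) : |(s : ℝ)| ≤ 1 := by
  cases s <;> simp

theorem norm_signType_le (s : SignType) : ‖(s : ℂ)‖ ≤ 1 := by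
  cases s <;> simp

theorem measurable_signDiff (τ : SignType) :
    Measurable fun p : (EuclideanSpace ℂ (Fin n) × ℝ) × (EuclideanSpace ℂ (Fin n) × ℝ) =>
      ((signDiff τ p.1.2 p.2.2 : SignType) : ℝ) := by
  have e : (fun p : (EuclideanSpace ℂ (Fin n) × ℝ) × (EuclideanSpace ℂ (Fin n) × ℝ) =>
      ((signDiff τ p.1.2 p.2.2 : SignType) : ℝ)) = fun p =>
        if p.2.2 < p.1.2 then 1 else if p.1.2 < p.2.2 then -1 else (τ : ℝ) := by
    funext p
    unfold signDiff
    split_ifs <;> simp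
  rw [e]
  exact Measurable.ite (measurableSet_lt (by fun_prop) (by fun_prop)) measurable_const
    (Measurable.ite (measurableSet_lt (by fun_prop) (by fun_prop)) measurable_const
      measurable_const)

theorem measurable_pairForm (τ : SignType) (u : EuclideanSpace ℂ (Fin n)) :
    Measurable (pairForm τ u) := by
  refine (measurable_signDiff τ).mul (Continuous.measurable ?_)
  fun_prop

/-- A difference of nonnegative numbers is bounded by their maximum. Using the maximum and not the
sum lets the exponential moment split into two one-vector moments with the same exponent. -/
theorem abs_pairForm_le (τ : SignType) (u : EuclideanSpace ℂ (Fin n))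
    (p : (EuclideanSpace ℂ (Fin n) × ℝ) × (EuclideanSpace ℂ (Fin n) × ℝ)) :
    |pairForm τ u p| ≤ max (‖inner ℂ p.1.1 u‖ ^ 2) (‖inner ℂ p.2.1 u‖ ^ 2) := by
  rw [pairForm, abs_mul]
  refine (mul_le_of_le_one_left (abs_nonneg _) (abs_signType_le _)).trans ?_
  exact abs_sub_le_of_nonneg_of_le (by positivity) (le_max_left _ _) (by positivity)
    (le_max_right _ _)

theorem isHermitian_pairMatrix (τ : SignType) (u v : EuclideanSpace ℂ (Fin n) × ℝ) :
    (pairMatrix τ u v).IsHermitian := by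
  ext j k
  simp only [pairMatrix, ← ofReal_signType, Matrix.conjTranspose_apply, Matrix.smul_apply,
    Matrix.sub_apply, Matrix.vecMulVec_apply, Pi.star_apply, smul_eq_mul, star_mul', star_sub,
    RCLike.star_def, Complex.conj_ofReal, Complex.conj_conj]
  ring

theorem isHermitian_empiricalMatrix (τ : SignType) {m : ℕ}
    (w : Fin m → Fin 2 → EuclideanSpace ℂ (Fin n) × ℝ) : (empiricalMatrix τ w).IsHermitian := by
  have h : IsSelfAdjoint (∑ i, pairMatrix τ (w i 0) (w i 1)) :=
    isSelfAdjoint_sum _ fun i _ => isHermitian_pairMatrix τ _ _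
  exact IsSelfAdjoint.smul (by simp [IsSelfAdjoint]) h

theorem isHermitian_expectedMatrix (τ : SignType) (θ : Kernel ℝ ℝ)
    (x₀ : EuclideanSpace ℂ (Fin n)) : (expectedMatrix τ θ x₀).IsHermitian := by
  ext j k
  simp only [expectedMatrix, Matrix.conjTranspose_apply, Matrix.of_apply, RCLike.star_def]
  rw [← integral_conj]
  congr 1
  funext p
  exact (isHermitian_pairMatrix τ p.1 p.2).apply j k

end QuadraticForm

/-! ### Exponential moments of the form, and its expectation. -/

section Expectation

variable {n : ℕ} (τ : SignType) (θ : Kernel ℝ ℝ) [IsMarkovKernel θ]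
  (x₀ : EuclideanSpace ℂ (Fin n))

instance : IsProbabilityMeasure (measurementLaw θ x₀) := by
  unfold measurementLaw
  infer_instance

theorem measurePreserving_fst_measurementLaw :
    MeasurePreserving Prod.fst (measurementLaw θ x₀) (complexGaussian n) :=
  ⟨measurable_fst, Measure.fst_compProd _ _⟩

theorem measurePreserving_fst_fst :
    MeasurePreserving (fun p => p.1.1) ((measurementLaw θ x₀).prod (measurementLaw θ x₀))
      (complexGaussian n) :=
  (measurePreserving_fst_measurementLaw θ x₀).comp measurePreserving_fst

theorem measurePreserving_snd_fst :
    MeasurePreserving (fun p => p.2.1) ((measurementLaw θ x₀).prod (measurementLaw θ x₀))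
      (complexGaussian n) :=
  (measurePreserving_fst_measurementLaw θ x₀).comp measurePreserving_snd

theorem exp_moment_pairForm {γ M : ℝ} (hγ : 0 < γ) {u : EuclideanSpace ℂ (Fin n)}
    (hint : Integrable (fun a => Real.exp (γ * ‖inner ℂ a u‖ ^ 2)) (complexGaussian n))
    (hM : ∫ a, Real.exp (γ * ‖inner ℂ a u‖ ^ 2) ∂(complexGaussian n) ≤ M) :
    Integrable (fun p => Real.exp (γ * |pairForm τ u p|))
        ((measurementLaw θ x₀).prod (measurementLaw θ x₀)) ∧
      ∫ p, Real.exp (γ * |pairForm τ u p|)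
        ∂((measurementLaw θ x₀).prod (measurementLaw θ x₀)) ≤ 2 * M := by
  have m1 := measurePreserving_fst_fst θ x₀
  have m2 := measurePreserving_snd_fst θ x₀
  have i1 := m1.integrable_comp_of_integrable hint
  have i2 := m2.integrable_comp_of_integrable hint
  have hpt : ∀ p, Real.exp (γ * |pairForm τ u p|) ≤
      Real.exp (γ * ‖inner ℂ p.1.1 u‖ ^ 2) + Real.exp (γ * ‖inner ℂ p.2.1 u‖ ^ 2) := by
    intro p
    have h := abs_pairForm_le τ u p
    rcases le_max_iff.1 h with h | h
    · have : Real.exp (γ * |pairForm τ u p|) ≤ Real.exp (γ * ‖inner ℂ p.1.1 u‖ ^ 2) := by gcongr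
      linarith [Real.exp_pos (γ * ‖inner ℂ p.2.1 u‖ ^ 2)]
    · have : Real.exp (γ * |pairForm τ u p|) ≤ Real.exp (γ * ‖inner ℂ p.2.1 u‖ ^ 2) := by gcongr
      linarith [Real.exp_pos (γ * ‖inner ℂ p.1.1 u‖ ^ 2)]
  have hi : Integrable (fun p => Real.exp (γ * |pairForm τ u p|))
      ((measurementLaw θ x₀).prod (measurementLaw θ x₀)) := by
    refine (i1.add i2).mono' ?_ (ae_of_all _ fun p => ?_)
    · have := measurable_pairForm τ u
      exact (Real.measurable_exp.comp ((measurable_norm.comp this).const_mul γ)).aestronglyMeasurable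
    · rw [Real.norm_of_nonneg (Real.exp_pos _).le]
      exact hpt p
  refine ⟨hi, (integral_mono hi (i1.add i2) hpt).trans ?_⟩
  rw [integral_add' i1 i2]
  have e1 := m1.hasLaw.integral_comp hint.aestronglyMeasurable
  have e2 := m2.hasLaw.integral_comp hint.aestronglyMeasurable
  rw [e1, e2]
  linarith

theorem integrable_norm_sq_complexGaussian :
    Integrable (fun a => ‖a‖ ^ 2) (complexGaussian n) := by
  obtain ⟨γ, hγ, M, h⟩ := exists_exp_moment_complexGaussian
  simp only [EuclideanSpace.norm_sq_eq]
  refine integrable_finsetSum _ fun k _ => ?_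
  obtain ⟨hi, -⟩ := h n (EuclideanSpace.single k 1) (by simp)
  refine (hi.const_mul γ⁻¹).mono' (Continuous.aestronglyMeasurable (by fun_prop))
    (ae_of_all _ fun a => ?_)
  rw [Real.norm_of_nonneg (by positivity), inv_mul_eq_div, le_div_iff₀ hγ]
  have e : ‖inner ℂ a (EuclideanSpace.single k (1 : ℂ))‖ = ‖a k‖ := by
    simp [EuclideanSpace.inner_single_right]
  rw [e]
  linarith [Real.add_one_le_exp (γ * ‖a k‖ ^ 2)]

theorem integrable_pairMatrix_apply (j k : Fin n) :
    Integrable (fun p => pairMatrix τ p.1 p.2 j k)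
      ((measurementLaw θ x₀).prod (measurementLaw θ x₀)) := by
  have i1 := (measurePreserving_fst_fst θ x₀).integrable_comp_of_integrable
    (integrable_norm_sq_complexGaussian (n := n))
  have i2 := (measurePreserving_snd_fst θ x₀).integrable_comp_of_integrable
    (integrable_norm_sq_complexGaussian (n := n))
  have hb : ∀ a : EuclideanSpace ℂ (Fin n), ‖a j * star (a k)‖ ≤ ‖a‖ ^ 2 := by
    intro a
    rw [norm_mul, norm_star, sq]
    exact mul_le_mul (PiLp.norm_apply_le a j) (PiLp.norm_apply_le a k) (norm_nonneg _)
      (norm_nonneg _)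
  have e : ∀ p : (EuclideanSpace ℂ (Fin n) × ℝ) × (EuclideanSpace ℂ (Fin n) × ℝ),
      pairMatrix τ p.1 p.2 j k = (((signDiff τ p.1.2 p.2.2 : SignType) : ℝ) : ℂ) *
        (p.1.1 j * star (p.1.1 k) - p.2.1 j * star (p.2.1 k)) := by
    intro p
    rw [ofReal_signType]
    rfl
  simp only [e]
  refine (i1.add i2).mono' ?_ (ae_of_all _ fun p => ?_)
  · refine (Complex.measurable_ofReal.comp (measurable_signDiff τ)).aestronglyMeasurable.mul ?_
    exact Continuous.aestronglyMeasurable (by fun_prop)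
  · rw [norm_mul, ofReal_signType]
    refine (mul_le_of_le_one_left (norm_nonneg _) (norm_signType_le _)).trans ?_
    exact (norm_sub_le _ _).trans (add_le_add (hb _) (hb _))

/-- The form is a finite sum over the entries, each integrable, so the entrywise expectation
commutes with it. -/
theorem re_inner_expectedMatrix (u : EuclideanSpace ℂ (Fin n)) :
    (inner ℂ (Matrix.toEuclideanCLM (n := Fin n) (𝕜 := ℂ) (expectedMatrix τ θ x₀) u) u).re =
      ∫ p, pairForm τ u p ∂((measurementLaw θ x₀).prod (measurementLaw θ x₀)) := by
  have hi : ∀ j k, Integrable (fun p => u j * star (pairMatrix τ p.1 p.2 j k) * star (u k))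
      ((measurementLaw θ x₀).prod (measurementLaw θ x₀)) := fun j k =>
    (((Complex.conjCLE.toContinuousLinearMap.integrable_comp
      (integrable_pairMatrix_apply τ θ x₀ j k)).const_mul (u j)).mul_const _)
  have hs := fun j => integrable_finsetSum Finset.univ fun k _ => hi j k
  have e : ∀ p, pairForm τ u p =
      Complex.reCLM (∑ j, ∑ k, u j * star (pairMatrix τ p.1 p.2 j k) * star (u k)) := by
    intro p
    rw [← re_inner_pairMatrix, inner_toEuclideanCLM_apply]
    rfl
  simp only [e]
  rw [ContinuousLinearMap.integral_comp_comm _ (integrable_finsetSum Finset.univ fun j _ => hs j),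
    integral_finsetSum _ fun j _ => hs j, inner_toEuclideanCLM_apply]
  change Complex.re _ = Complex.re _
  congr 1
  refine Finset.sum_congr rfl fun j _ => ?_
  rw [integral_finsetSum _ fun k _ => hi j k]
  refine Finset.sum_congr rfl fun k _ => ?_
  rw [integral_mul_const, integral_const_mul]
  congr 2
  exact integral_conj.symm

end Expectation

theorem re_inner_empiricalMatrix {n m : ℕ} (τ : SignType)
    (w : Fin m → Fin 2 → EuclideanSpace ℂ (Fin n) × ℝ) (u : EuclideanSpace ℂ (Fin n)) :
    (inner ℂ (Matrix.toEuclideanCLM (n := Fin n) (𝕜 := ℂ) (empiricalMatrix τ w) u) u).re =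
      (m : ℝ)⁻¹ * ∑ i, pairForm τ u (w i 0, w i 1) := by
  rw [empiricalMatrix, map_smul, map_sum, smul_apply, sum_apply,
    inner_smul_left, sum_inner, map_inv₀, Complex.conj_natCast, ← Complex.ofReal_natCast,
    ← Complex.ofReal_inv, Complex.re_ofReal_mul, Complex.re_sum]
  simp only [← re_inner_pairMatrix]

/-! ### Concentration at one vector, then in operator norm. -/

section Concentration

variable {n m : ℕ} (τ : SignType) (θ : Kernel ℝ ℝ) [IsMarkovKernel θ]
  (x₀ : EuclideanSpace ℂ (Fin n)) {Ω : Type*} [MeasurableSpace Ω] {P : Measure Ω}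
  [IsProbabilityMeasure P] {W : Fin m × Fin 2 → Ω → EuclideanSpace ℂ (Fin n) × ℝ}

theorem measureReal_quadraticForm_gt_le (hlaw : ∀ p, HasLaw (W p) (measurementLaw θ x₀) P)
    (hind : iIndepFun W P) {γ M : ℝ} (hγ : 0 < γ) {u : EuclideanSpace ℂ (Fin n)}
    (hint : Integrable (fun a => Real.exp (γ * ‖inner ℂ a u‖ ^ 2)) (complexGaussian n))
    (hM : ∫ a, Real.exp (γ * ‖inner ℂ a u‖ ^ 2) ∂(complexGaussian n) ≤ M)
    {s t : ℝ} (hs₀ : 0 ≤ s) (hs : s ≤ γ / 2) :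
    P.real {ω | t < |(inner ℂ (Matrix.toEuclideanCLM (n := Fin n) (𝕜 := ℂ)
        (empiricalMatrix τ (fun i j => W (i, j) ω) - expectedMatrix τ θ x₀) u) u).re|} ≤
      2 * Real.exp (-(m * (s * t - 16 / γ ^ 2 * (2 * M) * s ^ 2))) := by
  -- For `m = 0` the right-hand side is 2, so nothing is to be proved; otherwise the sum may be
  -- divided by `m`.
  rcases Nat.eq_zero_or_pos m with rfl | hm
  · have h : P.real {ω | t < |(inner ℂ (Matrix.toEuclideanCLM (n := Fin n) (𝕜 := ℂ)
        (empiricalMatrix τ (fun i j => W (i, j) ω) - expectedMatrix τ θ x₀) u) u).re|} ≤ 1 :=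
      measureReal_le_one
    simpa using h.trans one_le_two
  obtain ⟨i1, i2⟩ := exp_moment_pairForm τ θ x₀ hγ hint hM
  have hpair : ∀ i, HasLaw (fun ω => (W (i, 0) ω, W (i, 1) ω))
      ((measurementLaw θ x₀).prod (measurementLaw θ x₀)) P := fun i =>
    (indepFun_iff_hasLaw_prodMk_prod (hlaw (i, 0)) (hlaw (i, 1))).1
      (hind.indepFun (by simp))
  have hF := measurable_pairForm τ u
  have hXm : ∀ i, AEMeasurable (fun ω => pairForm τ u (W (i, 0) ω, W (i, 1) ω)) P := fun i =>
    hF.comp_aemeasurable (hpair i).aemeasurable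
  have hXind : iIndepFun (fun i ω => pairForm τ u (W (i, 0) ω, W (i, 1) ω)) P :=
    (iIndepFun_curry (fun p => (hlaw p).aemeasurable) hind).comp
      (fun _ f => pairForm τ u (f 0, f 1)) fun _ => hF.comp (by fun_prop)
  have hsum := measureReal_abs_sum_ge_le (t := t) hXm hXind hγ
    (fun i => (hpair i).integral_comp hF.aestronglyMeasurable)
    (fun i => by
      have h := i1
      rw [← (hpair i).map_eq] at h
      exact h.comp_aemeasurable (hpair i).aemeasurable)
    (fun i => ((hpair i).integral_comp i1.aestronglyMeasurable).trans_le i2) hs₀ hs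
  refine (measureReal_mono fun ω hω => ?_).trans hsum
  have hm' : (0 : ℝ) < m := by exact_mod_cast hm
  rw [Set.mem_ofPred_eq, map_sub, sub_apply, inner_sub_left, Complex.sub_re,
    re_inner_empiricalMatrix, re_inner_expectedMatrix] at hω
  rw [Set.mem_ofPred_eq, Finset.sum_sub_distrib, Finset.sum_const, Finset.card_univ,
    Fintype.card_fin, nsmul_eq_mul]
  set S := ∑ i, pairForm τ u (W (i, 0) ω, W (i, 1) ω)
  have e : ∀ μ : ℝ, S - m * μ = m * ((m : ℝ)⁻¹ * S - μ) := fun μ => by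
    field_simp
  rw [e, abs_mul, abs_of_pos hm']
  gcongr

/-- Union bound over a net. -/
theorem measureReal_opNorm_gt_le (hlaw : ∀ p, HasLaw (W p) (measurementLaw θ x₀) P)
    (hind : iIndepFun W P) {γ M : ℝ} (hγ : 0 < γ)
    (hG : ∀ u : EuclideanSpace ℂ (Fin n), ‖u‖ = 1 →
      Integrable (fun a => Real.exp (γ * ‖inner ℂ a u‖ ^ 2)) (complexGaussian n) ∧
        ∫ a, Real.exp (γ * ‖inner ℂ a u‖ ^ 2) ∂(complexGaussian n) ≤ M)
    {s t : ℝ} (hs₀ : 0 ≤ s) (hs : s ≤ γ / 2) (ht : 0 ≤ t) :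
    P.real {ω | opNorm (empiricalMatrix τ (fun i j => W (i, j) ω) - expectedMatrix τ θ x₀) ≤
        4 * t}ᶜ ≤
      25 ^ (2 * n) * (2 * Real.exp (-(m * (s * t - 16 / γ ^ 2 * (2 * M) * s ^ 2)))) := by
  obtain ⟨N, hcard, hN⟩ := exists_quarter_net (E := EuclideanSpace ℂ (Fin n))
  have hdim : Module.finrank ℝ (EuclideanSpace ℂ (Fin n)) = 2 * n := by
    rw [finrank_real_of_complex, finrank_euclideanSpace, Fintype.card_fin]
  rw [hdim] at hcard
  -- The threshold scales like the form, so each nonzero net point reduces to a unit vector; the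
  -- strict inequality makes the event at `v = 0` empty.
  let B : EuclideanSpace ℂ (Fin n) → Set Ω := fun v =>
    {ω | t * ‖v‖ ^ 2 < |(inner ℂ (Matrix.toEuclideanCLM (n := Fin n) (𝕜 := ℂ)
        (empiricalMatrix τ (fun i j => W (i, j) ω) - expectedMatrix τ θ x₀) v) v).re|}
  have hB : ∀ v, P.real (B v) ≤
      2 * Real.exp (-(m * (s * t - 16 / γ ^ 2 * (2 * M) * s ^ 2))) := by
    intro v
    by_cases hv : v = 0
    · have : B v = ∅ := by
        ext ω
        simp [B, hv]
      rw [this, measureReal_empty]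
      positivity
    · have hv' : 0 < ‖v‖ := norm_pos_iff.2 hv
      have hn : ‖((‖v‖ : ℂ)⁻¹) • v‖ = 1 := by
        rw [norm_smul]
        simp [hv]
      obtain ⟨h1, h2⟩ := hG _ hn
      refine (measureReal_mono fun ω hω => ?_).trans
        (measureReal_quadraticForm_gt_le τ θ x₀ hlaw hind hγ h1 h2 (t := t) hs₀ hs)
      simp only [B, Set.mem_ofPred_eq] at hω ⊢
      rw [map_smul, inner_smul_left, inner_smul_right, map_inv₀, Complex.conj_ofReal,
        ← mul_assoc, ← Complex.ofReal_inv, ← Complex.ofReal_mul, Complex.re_ofReal_mul, abs_mul,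
        abs_of_pos (by positivity), ← mul_inv, inv_mul_eq_div, lt_div_iff₀ (by positivity), ← sq]
      exact hω
  have hsub : {ω | opNorm (empiricalMatrix τ (fun i j => W (i, j) ω) - expectedMatrix τ θ x₀) ≤
        4 * t}ᶜ ⊆ ⋃ v ∈ N, B v := by
    intro ω hω
    by_contra hcon
    apply hω
    simp only [B, Set.mem_iUnion, Set.mem_ofPred_eq, not_exists, not_lt] at hcon
    refine norm_le_of_net _ ?_ N hN ht hcon
    rw [← ContinuousLinearMap.isSelfAdjoint_iff_isSymmetric]
    exact IsSelfAdjoint.map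
      (IsSelfAdjoint.sub (isHermitian_empiricalMatrix τ _) (isHermitian_expectedMatrix τ θ x₀)) _
  refine (measureReal_mono hsub (measure_ne_top P _)).trans
    ((measureReal_biUnion_finset_le _ _).trans ?_)
  refine (Finset.sum_le_sum fun v _ => hB v).trans ?_
  rw [Finset.sum_const, nsmul_eq_mul]
  gcongr
  exact_mod_cast hcard

end Concentration

/-! ### Choice of constants and conclusion. -/

/-- The net costs `exp (7n)` and the factor `n ^ 2` costs `exp (2n)`, whence 9. Either `log n ≥ 9/δ`
and the logarithm wins, or `n < exp (9/δ)` and the constant covers the cost. -/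
theorem pow_mul_exp_neg_mul_log_le {δ : ℝ} (hδ : 0 < δ) {n : ℕ} (hn : 0 < n) :
    25 ^ (2 * n) * (2 * Real.exp (-(δ * (n * Real.log n)))) ≤
      2 * Real.exp (9 * Real.exp (9 / δ)) / (n : ℝ) ^ 2 := by
  have hn' : (0 : ℝ) < n := by exact_mod_cast hn
  have h1 : (n : ℝ) ^ 2 ≤ Real.exp (2 * n) := by
    have h : (n : ℝ) ≤ Real.exp n := by linarith [Real.add_one_le_exp (n : ℝ)]
    calc (n : ℝ) ^ 2 ≤ Real.exp n ^ 2 := by gcongr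
      _ = _ := by rw [← Real.exp_nat_mul]; norm_num
  have h2 : (25 : ℝ) ^ (2 * n) ≤ Real.exp (7 * n) := by
    have h : (25 : ℝ) ^ 2 ≤ Real.exp 7 := by
      have e : Real.exp 7 = Real.exp 1 ^ 7 := by rw [← Real.exp_nat_mul]; norm_num
      rw [e]
      calc (25 : ℝ) ^ 2 ≤ 2.7 ^ 7 := by norm_num
        _ ≤ _ := by
          have := Real.exp_one_gt_d9
          gcongr
          linarith
    rw [pow_mul, mul_comm (7 : ℝ), Real.exp_nat_mul]
    gcongr
  have h3 : 9 * n - δ * (n * Real.log n) ≤ 9 * Real.exp (9 / δ) := by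
    rcases le_or_gt (9 / δ) (Real.log n) with h | h
    · rw [div_le_iff₀ hδ] at h
      nlinarith [Real.exp_pos (9 / δ)]
    · have h4 : (n : ℝ) ≤ Real.exp (9 / δ) := (Real.log_le_iff_le_exp hn').1 h.le
      have h5 : 0 ≤ Real.log n := Real.log_natCast_nonneg n
      have : 0 ≤ δ * (n * Real.log n) := by positivity
      linarith
  rw [le_div_iff₀ (by positivity)]
  calc 25 ^ (2 * n) * (2 * Real.exp (-(δ * (n * Real.log n)))) * (n : ℝ) ^ 2
      ≤ Real.exp (7 * n) * (2 * Real.exp (-(δ * (n * Real.log n)))) * Real.exp (2 * n) := by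
        gcongr
    _ = 2 * Real.exp (9 * n - δ * (n * Real.log n)) := by
        rw [mul_left_comm, mul_assoc, ← Real.exp_add, ← Real.exp_add]
        ring_nf
    _ ≤ _ := by gcongr

end OneBitPhase

theorem mainTheorem6 :
    ∃ c : ℝ, 0 < c ∧ ∀ lam : ℝ, 0 < lam → ∃ K : ℝ,
      ∀ (τ : SignType) (θ : Kernel ℝ ℝ) [IsMarkovKernel θ], OneBitPhase.snr τ θ = lam →
        ∀ (n m : ℕ) (x₀ : EuclideanSpace ℂ (Fin n)), ‖x₀‖ = 1 →
          ∀ ε : ℝ, 0 < ε → ε ≤ 1 →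
            c * n * Real.log n / (lam * ε ^ 2) ≤ (m : ℝ) →
              ∀ (Ω : Type*) [MeasurableSpace Ω] (P : Measure Ω) [IsProbabilityMeasure P]
                (a : Fin m → Fin 2 → Ω → EuclideanSpace ℂ (Fin n)) (b : Fin m → Fin 2 → Ω → ℝ),
                (∀ i j, HasLaw (fun ω => (a i j ω, b i j ω))
                  (OneBitPhase.measurementLaw θ x₀) P) →
                iIndepFun (fun (p : Fin m × Fin 2) ω => (a p.1 p.2 ω, b p.1 p.2 ω)) P →
                  1 - K / (n : ℝ) ^ 2 ≤
                    P.real {ω | OneBitPhase.opNorm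
                        (OneBitPhase.empiricalMatrix τ (fun i j => (a i j ω, b i j ω)) -
                          OneBitPhase.expectedMatrix τ θ x₀) ≤ ε * lam} := by
  obtain ⟨γ, hγ, M₀, hG⟩ := OneBitPhase.exists_exp_moment_complexGaussian
  set M := max M₀ 1 with hMdef
  have hMpos : 0 < M := lt_max_of_lt_right one_pos
  set V := 16 / γ ^ 2 * (2 * M) with hV
  have hVpos : 0 < V := by positivity
  refine ⟨1, one_pos, fun lam hlam => ?_⟩
  -- With `s = εκ` and `t = ελ/4`, the first bound makes `s` admissible (as `ε ≤ 1`), and the second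
  -- makes `V s^2` at most half of `s t`.
  set κ := min (γ / 2) (lam / (8 * V)) with hκ
  have hκpos : 0 < κ := lt_min (by positivity) (by positivity)
  have hκV : V * κ ≤ lam / 8 := by
    have h := min_le_right (γ / 2) (lam / (8 * V))
    rw [← hκ, le_div_iff₀ (by positivity)] at h
    linarith
  refine ⟨2 * Real.exp (9 * Real.exp (9 / (κ / 8))), ?_⟩
  intro τ θ _ _ n m x₀ hx₀ ε hε hε1 hm Ω _ P _ a b hlaw hind
  have hn : 0 < n := by
    rcases Nat.eq_zero_or_pos n with rfl | h
    · rw [Subsingleton.elim x₀ 0, norm_zero] at hx₀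
      exact absurd hx₀ zero_ne_one
    · exact h
  have hs : ε * κ ≤ γ / 2 :=
    (mul_le_of_le_one_left hκpos.le hε1).trans (min_le_left _ _)
  have hbad := OneBitPhase.measureReal_opNorm_gt_le τ θ x₀
    (W := fun p ω => (a p.1 p.2 ω, b p.1 p.2 ω)) (fun p => hlaw p.1 p.2) hind hγ
    (fun u hu => ⟨(hG n u hu).1, (hG n u hu).2.trans (le_max_left M₀ 1)⟩)
    (s := ε * κ) (t := ε * lam / 4) (by positivity) hs (by positivity)
  rw [show 4 * (ε * lam / 4) = ε * lam by ring] at hbad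
  have hexp : κ / 8 * (n * Real.log n) ≤
      m * (ε * κ * (ε * lam / 4) - V * (ε * κ) ^ 2) := by
    rw [div_le_iff₀ (by positivity), one_mul] at hm
    have h1 : ε ^ 2 * κ * (lam / 8) ≤ ε * κ * (ε * lam / 4) - V * (ε * κ) ^ 2 := by
      have : ε ^ 2 * κ * (V * κ) ≤ ε ^ 2 * κ * (lam / 8) := by gcongr
      linarith
    calc κ / 8 * (n * Real.log n) ≤ κ / 8 * (m * (lam * ε ^ 2)) := by gcongr
      _ = m * (ε ^ 2 * κ * (lam / 8)) := by ring
      _ ≤ _ := by gcongr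
  have hsmall := OneBitPhase.pow_mul_exp_neg_mul_log_le (by positivity : 0 < κ / 8) hn
  have hle : (25 : ℝ) ^ (2 * n) *
      (2 * Real.exp (-(m * (ε * κ * (ε * lam / 4) - V * (ε * κ) ^ 2)))) ≤
      25 ^ (2 * n) * (2 * Real.exp (-(κ / 8 * (n * Real.log n)))) := by
    gcongr
  -- Subadditivity replaces the formula for the complement, so measurability of the event is not
  -- needed.
  have hcov := measureReal_union_le (μ := P)
    {ω | OneBitPhase.opNorm (OneBitPhase.empiricalMatrix τ (fun i j => (a i j ω, b i j ω)) -
      OneBitPhase.expectedMatrix τ θ x₀) ≤ ε * lam}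
    {ω | OneBitPhase.opNorm (OneBitPhase.empiricalMatrix τ (fun i j => (a i j ω, b i j ω)) -
      OneBitPhase.expectedMatrix τ θ x₀) ≤ ε * lam}ᶜ
  rw [Set.union_compl_self, probReal_univ] at hcov
  linarith
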